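/- Let $\mathcal C$ be an elementary topos (a finitely complete cartesian closed category with a subobject classifier $\Omega$), let $X$ be an object of $\mathcal C$, let $PX=\Omega^X$ be its power object, with membership relation ${\in_X}\rightarrowtail X\times PX$, internal lattice operations $\wedge,\vee : PX\times PX\to PX$, and internal order ${\preceq_X}\rightarrowtail PX\times PX$, the equalizer of $\wedge$ and the first projection. Let $b : X\to PX$ be any morphism (a structuring element), corresponding to a relation $R_b\rightarrowtail X\times X$, and let $\breve b : X\to PX$ correspond to the image of $R_b$ under the exchange of the two factors; in the internal language, $\breve b(y)=\{x : X\mid y\in_X b(x)\}$. The erosion $\varepsilon[b] : PX\to PX$ is the morphism corresponding to the subobject of $PX\times X$ obtained by pulling back the reverse order $\succeq_X$ along $\mathrm{Id}\times b : PX\times X\to PX\times PX$; internally, $\varepsilon[b](Y)=\{x : X\mid b(x)\preceq_X Y\}$. The dilation $\delta[b] : PX\to PX$ is the morphism corresponding to the image of $R\rightarrowtail X\times X\times PX\to PX\times X$, where $R$ is the pullback of $R_{\breve b}\times{\in_X}$ along $(x,y,Y)\mapsto(x,y,y,Y)$ and the second morphism is $(x,y,Y)\mapsto(Y,x)$; internally,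 $\delta[b](Y)=\{x : X\mid \exists y.\; y\in_X\breve b(x)\wedge y\in_X Y\}$. Then the following formulas are valid in the internal language of $\mathcal C$ (a closed formula is valid if its interpretation is the largest subobject of the terminal object): 1. (Monotonicity) $\forall Y.\forall Z.\; Y\preceq_X Z\Rightarrow \varepsilon[b](Y)\preceq_X\varepsilon[b](Z)$ and $\forall Y.\forall Z.\; Y\preceq_X Z\Rightarrow \delta[b](Y)\preceq_X\delta[b](Z)$. 2. (Preservation of meets and joins, respectively) $\forall Y.\forall Z.\;\varepsilon[b](Y\wedge Z)=\varepsilon[b](Y)\wedge\varepsilon[b](Z)$ and $\forall Y.\forall Z.\;\delta[b](Y\vee Z)=\delta[b](Y)\vee\delta[b](Z)$. 3. $\varepsilon[b](X)=X$ and $\delta[b](\emptyset)=\emptyset$, where $X$ and $\emptyset$ are the constants of type $PX$ that correspond to the largest and to the smallest subobject of $X$. 4. $(\forall x.\; x\in_X b(x))\Leftrightarrow(\forall Y.\;\varepsilon[b](Y)\preceq_X Y)$. 5. $(\forall x.\; x\in_X b(x))\Leftrightarrow(\forall Y.\; Y\preceq_X\delta[b](Y))$. In particular, $\varepsilon[b]$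 is anti-extensive (that is, $\forall Y.\;\varepsilon[b](Y)\preceq_X Y$ is valid) if and only if $\forall x.\; x\in_X b(x)$ is valid, and $\delta[b]$ is extensive (that is, $\forall Y.\; Y\preceq_X\delta[b](Y)$ is valid) if and only if the same formula is valid. -/

import Mathlib

open CategoryTheory Limits MonoidalCategory CartesianMonoidalCategory

universe v u

set_option linter.unusedSectionVars false

noncomputable section

namespace ToposMorphology

/-! An elementary topos is a category `C` with chosen finite products
(`CartesianMonoidalCategory C`), all finite limits, exponentials (`MonoidalClosed C`) and a subobject
classifier (`HasSubobjectClassifier C`).  Nothing else is assumed: images and the Heyting algebra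
structure of the posets of subobjects are constructed below. -/

variable {C : Type u} [Category.{v} C] [CartesianMonoidalCategory C] [HasFiniteLimits C]
  [MonoidalClosed C] [HasSubobjectClassifier C]

/-! ### Subobjects, classifying morphisms, power objects -/

/-- The subobject of `A` classified by `f : A ⟶ Ω`, i.e. the pullback of `true` along `f`. -/
def extent {A : C} (f : A ⟶ HasSubobjectClassifier.Ω C) : Subobject A :=
  (Subobject.pullback f).obj (Subobject.mk (HasSubobjectClassifier.truth C))

/-- The characteristic morphism of a subobject. -/
def chi {A : C} (S : Subobject A) : A ⟶ HasSubobjectClassifier.Ω C :=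
  HasSubobjectClassifier.χ S.arrow

/-- The power object `PX = Ω ^ X`. -/
abbrev Pow (X : C) : C := (ihom X).obj (HasSubobjectClassifier.Ω C)

/-- The transposition `Hom(A × X, Ω) → Hom(A, PX)`. -/
def transpose {A X : C} (f : A ⊗ X ⟶ HasSubobjectClassifier.Ω C) : A ⟶ Pow X :=
  MonoidalClosed.curry (lift (snd X A) (fst X A) ≫ f)

/-- The transposition `Hom(A, PX) → Hom(A × X, Ω)`. -/
def untranspose {A X : C} (g : A ⟶ Pow X) : A ⊗ X ⟶ HasSubobjectClassifier.Ω C :=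
  lift (snd A X) (fst A X) ≫ MonoidalClosed.uncurry g

/-- The morphism `A ⟶ PX` corresponding to a relation `S ↣ A × X`; in the internal language,
`a ↦ {x : X | (a, x) ∈ S}`, that is, the term `{x : X | α}` for a formula `α` in context `A, x`. -/
def compr {A X : C} (S : Subobject (A ⊗ X)) : A ⟶ Pow X := transpose (chi S)

/-- The relation `R_f ↣ A × X` corresponding to `f : A ⟶ PX`; internally `{(a, x) | x ∈ f a}`. -/
def rel {A X : C} (f : A ⟶ Pow X) : Subobject (A ⊗ X) := extent (untranspose f)

/-- The membership relation `∈_X ↣ X × PX`, classified by the transpose of the identity. -/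
def memSub (X : C) : Subobject (X ⊗ Pow X) :=
  extent (MonoidalClosed.uncurry (𝟙 (Pow X)))

/-! ### Auxiliary facts on generalized elements -/

lemma extent_chi {A : C} (S : Subobject A) : extent (chi S) = S := by
  exact (Subobject.Classifier.pullback_χ_obj_mk_truth
    (HasSubobjectClassifier.exists_classifier (C := C)).some S.arrow).trans (by simp)

lemma chi_extent {A : C} (f : A ⟶ HasSubobjectClassifier.Ω C) : chi (extent f) = f :=
  Subobject.Classifier.χ_pullback_obj_mk_truth_arrow
    (HasSubobjectClassifier.exists_classifier (C := C)).some f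

lemma extent_comp {A B : C} (g : A ⟶ B) (f : B ⟶ HasSubobjectClassifier.Ω C) :
    extent (g ≫ f) = (Subobject.pullback g).obj (extent f) := by
  simp only [extent, Subobject.pullback_comp]

lemma comp_chi {A B : C} (g : A ⟶ B) (S : Subobject B) :
    g ≫ chi S = chi ((Subobject.pullback g).obj S) := by
  rw [← chi_extent (g ≫ chi S), extent_comp, extent_chi]

lemma chi_injective {A : C} : Function.Injective (chi (A := A)) := fun S T h => by
  rw [← extent_chi S, h, extent_chi]

lemma compr_injective {A X : C} : Function.Injective (compr (A := A) (X := X)) := fun S T h => by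
  have h1 := MonoidalClosed.curry_injective h
  have h2 := congrArg (fun k => lift (snd A X) (fst A X) ≫ k) h1
  simp only [← Category.assoc, comp_lift, lift_snd, lift_fst, lift_fst_snd, Category.id_comp] at h2
  exact chi_injective h2

lemma comp_compr {A B X : C} (g : B ⟶ A) (S : Subobject (A ⊗ X)) :
    g ≫ compr S = compr ((Subobject.pullback (g ▷ X)).obj S) := by
  unfold compr transpose
  rw [← MonoidalClosed.curry_natural_left, ← comp_chi, ← Category.assoc, ← Category.assoc]
  congr 2
  ext <;> simp

lemma le_iff_factors {A : C} {S T : Subobject A} :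
    S ≤ T ↔ ∀ {D : C} (t : D ⟶ A), S.Factors t → T.Factors t := by
  constructor
  · intro h D t ht
    exact Subobject.factors_of_le t h ht
  · intro h
    have := h S.arrow (Subobject.factors_self S)
    exact Subobject.le_of_comm (T.factorThru _ this) (by simp)

lemma factors_comp {A D E : C} {S : Subobject A} {t : D ⟶ A} (h : S.Factors t) (r : E ⟶ D) :
    S.Factors (r ≫ t) := Subobject.factors_of_factors_right r h

lemma eq_top_iff_factors {A : C} {S : Subobject A} :
    S = ⊤ ↔ ∀ {D : C} (t : D ⟶ A), S.Factors t := by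
  rw [← top_le_iff, le_iff_factors]
  exact ⟨fun h _ t => h t (Subobject.top_factors t), fun h _ t _ => h t⟩

/-! ### Implication and universal quantification of subobjects -/

/-- Heyting implication of subobjects: the equalizer of (the classifying morphisms of)
`S ∧ T` and `S`. -/
def impSub {A : C} (S T : Subobject A) : Subobject A := equalizerSubobject (chi (S ⊓ T)) (chi S)

/-- The universal quantifier `∀_p : Sub(A × X) → Sub(A)` along the projection `p : A × X ⟶ A`. -/
def allSub {A X : C} (S : Subobject (A ⊗ X)) : Subobject A :=
  equalizerSubobject (compr S) (compr (⊤ : Subobject (A ⊗ X)))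

lemma factors_impSub {A : C} (S T : Subobject A) {D : C} (t : D ⟶ A) :
    (impSub S T).Factors t ↔ ∀ {E : C} (r : E ⟶ D), S.Factors (r ≫ t) → T.Factors (r ≫ t) := by
  rw [impSub, equalizerSubobject_factors_iff, comp_chi, comp_chi, chi_injective.eq_iff,
    Subobject.inf_pullback, inf_eq_left, le_iff_factors]
  simp only [pullback_factors_iff]

lemma factors_allSub {A X : C} (S : Subobject (A ⊗ X)) {D : C} (t : D ⟶ A) :
    (allSub S).Factors t ↔ ∀ {E : C} (r : E ⟶ D) (x : E ⟶ X), S.Factors (lift (r ≫ t) x) := by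
  rw [allSub, equalizerSubobject_factors_iff, comp_compr, comp_compr, compr_injective.eq_iff,
    Subobject.pullback_top, eq_top_iff_factors]
  simp only [pullback_factors_iff]
  constructor
  · intro h E r x
    simpa using h (lift r x)
  · intro h E r
    have := h (r ≫ fst _ _) (r ≫ snd _ _)
    convert this using 1
    ext <;> simp

/-- `∀_p` is right adjoint to pullback along the projection `p`. -/
lemma allSub_gc {A X : C} (T : Subobject A) (S : Subobject (A ⊗ X)) :
    (Subobject.pullback (fst A X)).obj T ≤ S ↔ T ≤ allSub S := by
  simp only [le_iff_factors, factors_allSub, pullback_factors_iff]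
  constructor
  · intro h D t ht E r x
    exact h _ (by simpa using factors_comp ht r)
  · intro h D t ht
    have := h _ ht (𝟙 _) (t ≫ snd _ _)
    convert this using 1
    ext <;> simp

/-- The generic truth value as a subobject of `A × Ω`. -/
def genSub (A : C) : Subobject (A ⊗ HasSubobjectClassifier.Ω C) := extent (snd _ _)

lemma factors_genSub {A D : C} (t : D ⟶ A) (S : Subobject D) {E : C} (r : E ⟶ D) :
    (genSub A).Factors (r ≫ lift t (chi S)) ↔ S.Factors r := by
  rw [← pullback_factors_iff, genSub, ← extent_comp, lift_snd, extent_chi]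

lemma factors_genSub_lift {A D : C} (t : D ⟶ A) (S : Subobject A) :
    (genSub A).Factors (lift t (t ≫ chi S)) ↔ S.Factors t := by
  have := factors_genSub (𝟙 A) S t
  simpa using this

/-- The smallest subobject, `{a | ∀ p : Ω, p}`. -/
def botSub (A : C) : Subobject A := allSub (genSub A)

/-- The join of two subobjects, `{a | ∀ p : Ω, (S a ⇒ p) ∧ (T a ⇒ p) ⇒ p}`. -/
def supSub {A : C} (S T : Subobject A) : Subobject A :=
  allSub (impSub
    (impSub ((Subobject.pullback (fst _ _)).obj S) (genSub A) ⊓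
      impSub ((Subobject.pullback (fst _ _)).obj T) (genSub A)) (genSub A))

lemma botSub_le {A : C} (S : Subobject A) : botSub A ≤ S := by
  rw [le_iff_factors]
  intro D t ht
  have := (factors_allSub _ t).1 ht (𝟙 D) (t ≫ chi S)
  rw [Category.id_comp] at this
  exact (factors_genSub_lift t S).1 this

lemma le_supSub_left {A : C} (S T : Subobject A) : S ≤ supSub S T := by
  rw [le_iff_factors]
  intro D t ht
  rw [supSub, factors_allSub]
  intro E r x
  rw [factors_impSub]
  intro F s hs
  have h1 := (factors_impSub _ _ _).1 ((Subobject.inf_factors _).1 hs).1 (𝟙 F)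
  rw [Category.id_comp] at h1
  exact h1 (by simpa [pullback_factors_iff] using factors_comp ht (s ≫ r))

lemma le_supSub_right {A : C} (S T : Subobject A) : T ≤ supSub S T := by
  rw [le_iff_factors]
  intro D t ht
  rw [supSub, factors_allSub]
  intro E r x
  rw [factors_impSub]
  intro F s hs
  have h1 := (factors_impSub _ _ _).1 ((Subobject.inf_factors _).1 hs).2 (𝟙 F)
  rw [Category.id_comp] at h1
  exact h1 (by simpa [pullback_factors_iff] using factors_comp ht (s ≫ r))

lemma supSub_le {A : C} (S T U : Subobject A) (h₁ : S ≤ U) (h₂ : T ≤ U) : supSub S T ≤ U := by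
  rw [le_iff_factors]
  intro D t ht
  have h := (factors_allSub _ t).1 ht (𝟙 D) (t ≫ chi U)
  rw [Category.id_comp] at h
  have h' := (factors_impSub _ _ _).1 h (𝟙 D)
  rw [Category.id_comp] at h'
  refine (factors_genSub_lift t U).1 (h' ?_)
  have key : ∀ V : Subobject A, V ≤ U →
      (impSub ((Subobject.pullback (fst A (HasSubobjectClassifier.Ω C))).obj V)
        (genSub A)).Factors (lift t (t ≫ chi U)) := by
    intro V hV
    rw [factors_impSub]
    intro E r hr
    rw [pullback_factors_iff, Category.assoc, lift_fst] at hr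
    have := (factors_genSub_lift (r ≫ t) U).2 (Subobject.factors_of_le _ hV hr)
    simpa using this
  exact (Subobject.inf_factors _).2 ⟨key S h₁, key T h₂⟩

/-- In a topos the poset `Sub(A)` is a Heyting algebra (order, `⊓` and `⊤` are Mathlib's). -/
instance heytingAlgebraSubobject (A : C) : HeytingAlgebra (Subobject A) where
  __ := Subobject.semilatticeInf
  __ := Subobject.orderTop
  sup := supSub
  le_sup_left := le_supSub_left
  le_sup_right := le_supSub_right
  sup_le := supSub_le
  bot := botSub A
  bot_le := botSub_le
  himp := impSub
  le_himp_iff := by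
    intro S T U
    change S ≤ impSub T U ↔ S ⊓ T ≤ U
    simp only [le_iff_factors, factors_impSub, Subobject.inf_factors]
    constructor
    · intro h D t ht
      have := h t ht.1 (𝟙 D)
      simp only [Category.id_comp] at this
      exact this ht.2
    · intro h D t ht E r hr
      exact h _ ⟨factors_comp ht r, hr⟩
  compl S := impSub S (botSub A)
  himp_bot _ := rfl

/-! ### Images -/

/-- `{b : B | ∀ p : Ω, (∀ a : A, f a = b ⇒ p) ⇒ p}` -/
def imSub {A B : C} (f : A ⟶ B) : Subobject B :=
  allSub (impSub (allSub (impSub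
    (equalizerSubobject (snd (B ⊗ HasSubobjectClassifier.Ω C) A ≫ f) (fst _ _ ≫ fst _ _))
    ((Subobject.pullback (fst _ _)).obj (genSub B)))) (genSub B))

lemma imSub_factors {A B : C} (f : A ⟶ B) : (imSub f).Factors f := by
  rw [imSub, factors_allSub]
  intro E r x
  rw [factors_impSub]
  intro F s hs
  have h1 := (factors_allSub _ _).1 hs (𝟙 F) (s ≫ r)
  have h2 := (factors_impSub _ _ _).1 h1 (𝟙 F)
  simp only [Category.id_comp, equalizerSubobject_factors_iff, pullback_factors_iff,
    lift_fst] at h2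
  exact h2 (by simp)

lemma imSub_le {A B : C} (f : A ⟶ B) (S : Subobject B) (h : S.Factors f) : imSub f ≤ S := by
  rw [le_iff_factors]
  intro D t ht
  have h1 := (factors_allSub _ t).1 ht (𝟙 D) (t ≫ chi S)
  rw [Category.id_comp] at h1
  have h2 := (factors_impSub _ _ _).1 h1 (𝟙 D)
  rw [Category.id_comp] at h2
  refine (factors_genSub_lift t S).1 (h2 ?_)
  rw [factors_allSub]
  intro E r x
  rw [factors_impSub]
  intro F s hs
  rw [pullback_factors_iff]
  rw [equalizerSubobject_factors_iff] at hs
  have hs' : (s ≫ x) ≫ f = (s ≫ r) ≫ t := by simpa using hs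
  have h3 := (factors_genSub_lift ((s ≫ r) ≫ t) S).2 (by rw [← hs']; exact factors_comp h _)
  simpa using h3

/-- A topos has images. -/
instance hasImages_of_topos : HasImages C where
  has_image {A B} f := HasImage.mk
    { F :=
        { I := (imSub f : C)
          m := (imSub f).arrow
          e := (imSub f).factorThru f (imSub_factors f) }
      isImage :=
        { lift := fun F' => Subobject.ofLEMk _ F'.m (imSub_le f (Subobject.mk F'.m)
            ((Subobject.mk_factors_iff _ _).2 ⟨F'.e, F'.fac⟩))
          lift_fac := fun F' => by simp } }

/-! ### The internal language

A term of type `X` in context `Γ` (the product of the types of the variables) is interpreted by a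
morphism `Γ ⟶ X`, a formula in context `Γ` by a subobject of `Γ`.  In the context `Γ ⊗ X` obtained
from `Γ` by adding a variable `x : X`, the variable `x` is `snd Γ X`, and a term `t` of context `Γ`
becomes `fst Γ X ≫ t`.  Conjunction and implication of formulas are the operations `⊓`, `⇨` of the
Heyting algebra `Sub(Γ)`. -/

/-- The formula `σ = τ`. -/
def eqF {Γ X : C} (σ τ : Γ ⟶ X) : Subobject Γ := equalizerSubobject σ τ

/-- The formula `σ ∈_X τ`. -/
def memF {Γ X : C} (σ : Γ ⟶ X) (τ : Γ ⟶ Pow X) : Subobject Γ :=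
  (Subobject.pullback (lift σ τ)).obj (memSub X)

/-- The meet `∧ : PX × PX ⟶ PX` of the internal Heyting algebra `PX`:
`Y ∧ Z = {x | x ∈ Y ∧ x ∈ Z}`. -/
def meetP (X : C) : Pow X ⊗ Pow X ⟶ Pow X :=
  compr (memF (snd _ X) (fst (Pow X ⊗ Pow X) X ≫ fst _ _) ⊓
    memF (snd _ X) (fst (Pow X ⊗ Pow X) X ≫ snd _ _))

/-- The join `∨ : PX × PX ⟶ PX` of the internal Heyting algebra `PX`:
`Y ∨ Z = {x | x ∈ Y ∨ x ∈ Z}`. -/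
def joinP (X : C) : Pow X ⊗ Pow X ⟶ Pow X :=
  compr (memF (snd _ X) (fst (Pow X ⊗ Pow X) X ≫ fst _ _) ⊔
    memF (snd _ X) (fst (Pow X ⊗ Pow X) X ≫ snd _ _))

/-- The internal order `⪯_X ↣ PX × PX`: the equalizer of `∧` and the first projection. -/
def leSub (X : C) : Subobject (Pow X ⊗ Pow X) := equalizerSubobject (meetP X) (fst _ _)

/-- The reverse order `⪰_X ↣ PX × PX`. -/
def geSub (X : C) : Subobject (Pow X ⊗ Pow X) :=
  (Subobject.pullback (lift (snd _ _) (fst _ _))).obj (leSub X)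

/-- The formula `σ ⪯_X τ`. -/
def leF {Γ X : C} (σ τ : Γ ⟶ Pow X) : Subobject Γ :=
  (Subobject.pullback (lift σ τ)).obj (leSub X)

/-- The formula `∀ x : X. φ`. -/
def allF {Γ : C} (X : C) (φ : Subobject (Γ ⊗ X)) : Subobject Γ := allSub φ

/-- The formula `φ ⇔ ψ`. -/
def iffF {Γ : C} (φ ψ : Subobject Γ) : Subobject Γ := (φ ⇨ ψ) ⊓ (ψ ⇨ φ)

/-- The global element of `PX` (constant of type `PX`) that corresponds to a subobject of `X`
under `Sub(X) ≃ Hom(1, PX)`. -/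
def const {X : C} (S : Subobject X) : 𝟙_ C ⟶ Pow X :=
  compr ((Subobject.pullback (snd (𝟙_ C) X)).obj S)

/-- A closed formula is valid if its interpretation is the top element of `Sub(1)`. -/
def Valid (φ : Subobject (𝟙_ C)) : Prop := φ = ⊤

/-! ### Structuring elements, erosion and dilation -/

/-- The transpose `b̆` of a structuring element `b`, which corresponds to the image of
`R_b ↣ X × X ⟶ X × X`, the second morphism being the exchange of the two factors. -/
def breve {X : C} (b : X ⟶ Pow X) : X ⟶ Pow X :=
  compr (imageSubobject ((rel b).arrow ≫ lift (snd X X) (fst X X)))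

/-- The erosion `ε[b] : PX ⟶ PX` by `b : X ⟶ PX`: it corresponds to the pullback `R ↣ PX × X` of
`⪰_X` along `Id × b`. -/
def erosion {X : C} (b : X ⟶ Pow X) : Pow X ⟶ Pow X :=
  compr ((Subobject.pullback (Pow X ◁ b)).obj (geSub X))

instance mono_tensorHom {A B A' B' : C} (f : A ⟶ A') (g : B ⟶ B') [Mono f] [Mono g] :
    Mono (f ⊗ₘ g) where
  right_cancellation h k w := by
    have h1 := congrArg (fun t => t ≫ fst _ _) w
    have h2 := congrArg (fun t => t ≫ snd _ _) w
    simp only [Category.assoc, tensorHom_fst, tensorHom_snd] at h1 h2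
    simp only [← Category.assoc, cancel_mono] at h1 h2
    exact CartesianMonoidalCategory.hom_ext _ _ h1 h2

/-- The pullback `R ↣ X × X × PX` of `R_b̆ × ∈_X` along
`(x, y, Y) ↦ (x, y, y, Y)`. -/
def dilationRel {X : C} (b : X ⟶ Pow X) : Subobject (X ⊗ (X ⊗ Pow X)) :=
  (Subobject.pullback
    (lift (lift (fst _ _) (snd X (X ⊗ Pow X) ≫ fst _ _)) (snd X (X ⊗ Pow X)))).obj
    (Subobject.mk ((rel (breve b)).arrow ⊗ₘ (memSub X).arrow))

/-- The dilation `δ[b] : PX ⟶ PX` by `b : X ⟶ PX`: it corresponds to the image of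
`R ↣ X × X × PX ⟶ PX × X`, the second morphism being `(x, y, Y) ↦ (Y, x)`. -/
def dilation {X : C} (b : X ⟶ Pow X) : Pow X ⟶ Pow X :=
  compr (imageSubobject
    ((dilationRel b).arrow ≫ lift (snd X (X ⊗ Pow X) ≫ snd _ _) (fst _ _)))

/-! ### The formulas of the internal language about an operator `f : PX ⟶ PX`

In the context `Y, Z` of type `(1 × PX) × PX`, the variable `Z` is the second projection and `Y` is
the second projection after the first one. -/

/-- `∀ Y. ∀ Z. Y ⪯ Z ⇒ f(Y) ⪯ f(Z)` -/
def monotoneFormula {X : C} (f : Pow X ⟶ Pow X) : Subobject (𝟙_ C) :=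
  allF (Pow X) (allF (Pow X)
    (let Y : (𝟙_ C ⊗ Pow X) ⊗ Pow X ⟶ Pow X := fst _ _ ≫ snd _ _
     let Z : (𝟙_ C ⊗ Pow X) ⊗ Pow X ⟶ Pow X := snd _ _
     leF Y Z ⇨ leF (Y ≫ f) (Z ≫ f)))

/-- `∀ Y. ∀ Z. f(Y ∗ Z) = f(Y) ∗ f(Z)` for a binary operation `∗` on `PX` -/
def preservesFormula {X : C} (op : Pow X ⊗ Pow X ⟶ Pow X) (f : Pow X ⟶ Pow X) :
    Subobject (𝟙_ C) :=
  allF (Pow X) (allF (Pow X)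
    (let Y : (𝟙_ C ⊗ Pow X) ⊗ Pow X ⟶ Pow X := fst _ _ ≫ snd _ _
     let Z : (𝟙_ C ⊗ Pow X) ⊗ Pow X ⟶ Pow X := snd _ _
     eqF ((lift Y Z ≫ op) ≫ f) (lift (Y ≫ f) (Z ≫ f) ≫ op)))

/-- `f(c) = c` for a constant `c : PX` -/
def fixesFormula {X : C} (c : 𝟙_ C ⟶ Pow X) (f : Pow X ⟶ Pow X) : Subobject (𝟙_ C) :=
  eqF (c ≫ f) c

/-- `∀ Y. f(Y) ⪯ Y` -/
def antiExtensiveFormula {X : C} (f : Pow X ⟶ Pow X) : Subobject (𝟙_ C) :=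
  allF (Pow X)
    (let Y : 𝟙_ C ⊗ Pow X ⟶ Pow X := snd _ _
     leF (Y ≫ f) Y)

/-- `∀ Y. Y ⪯ f(Y)` -/
def extensiveFormula {X : C} (f : Pow X ⟶ Pow X) : Subobject (𝟙_ C) :=
  allF (Pow X)
    (let Y : 𝟙_ C ⊗ Pow X ⟶ Pow X := snd _ _
     leF Y (Y ≫ f))

/-- `∀ x. x ∈ b(x)` -/
def reflexiveFormula {X : C} (b : X ⟶ Pow X) : Subobject (𝟙_ C) :=
  allF X
    (let x : 𝟙_ C ⊗ X ⟶ X := snd _ _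
     memF x (x ≫ b))

end ToposMorphology

end

open ToposMorphology

open CategoryTheory Limits MonoidalCategory CartesianMonoidalCategory

noncomputable section

namespace ToposMorphology

variable {C : Type u} [Category.{v} C] [CartesianMonoidalCategory C] [HasFiniteLimits C]
  [MonoidalClosed C] [HasSubobjectClassifier C]

/-! ### Generalized elements of subobjects -/

lemma factors_iff_pullback_eq_top {A D : C} (S : Subobject A) (t : D ⟶ A) :
    S.Factors t ↔ (Subobject.pullback t).obj S = ⊤ := by
  rw [eq_top_iff_factors]
  simp only [pullback_factors_iff]
  exact ⟨fun h _ r => factors_comp h r, fun h => by simpa using h (𝟙 D)⟩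

/-- Elimination rule for the least subobject. -/
lemma factors_of_factors_bot {A D : C} {t : D ⟶ A} (h : (⊥ : Subobject A).Factors t)
    (U : Subobject D) : U.Factors (𝟙 D) := by
  -- The quantified truth value is instantiated at `chi U`, with `U` living over the stage `D`
  -- rather than over `A`; this is stronger than `⊥ ≤ S`.
  have h' := (factors_allSub (genSub A) t).1 h (𝟙 D) (chi U)
  rw [Category.id_comp] at h'
  exact (factors_genSub t U (𝟙 D)).1 (by simpa using h')

/-- Elimination rule for joins of subobjects. -/
lemma factors_of_factors_sup {A D : C} {S T : Subobject A} {t : D ⟶ A}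
    (h : (S ⊔ T).Factors t) (U : Subobject D)
    (hS : ∀ {E : C} (s : E ⟶ D), S.Factors (s ≫ t) → U.Factors s)
    (hT : ∀ {E : C} (s : E ⟶ D), T.Factors (s ≫ t) → U.Factors s) : U.Factors (𝟙 D) := by
  have h1 := (factors_allSub _ t).1 h (𝟙 D) (chi U)
  rw [Category.id_comp] at h1
  have h2 := (factors_impSub _ _ _).1 h1 (𝟙 D)
  refine (factors_genSub t U (𝟙 D)).1 (h2 ?_)
  -- With `p := chi U`, each premise `V ⇒ p` of the encoded disjunction is exactly one case of the
  -- case distinction.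
  have key : ∀ V : Subobject A,
      (∀ {E : C} (s : E ⟶ D), V.Factors (s ≫ t) → U.Factors s) →
      (impSub ((Subobject.pullback (fst A (HasSubobjectClassifier.Ω C))).obj V)
        (genSub A)).Factors (𝟙 D ≫ lift t (chi U)) := by
    intro V hV
    rw [factors_impSub]
    intro E r hr
    simp only [Category.id_comp, pullback_factors_iff, Category.assoc, lift_fst] at hr
    rw [Category.id_comp]
    exact (factors_genSub t U r).2 (hV r hr)
  exact (Subobject.inf_factors _).2 ⟨key S hS, key T hT⟩

/-- Minimality of the image. Only this inclusion is needed: it carries elements of the image to the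
impredicative `imSub`, from which they can be eliminated. -/
lemma imageSubobject_le_imSub {A B : C} (f : A ⟶ B) : imageSubobject f ≤ imSub f :=
  imageSubobject_le f ((imSub f).factorThru f (imSub_factors f)) (by simp)

lemma factors_imageSubobject_of_eq {A B D : C} {f : A ⟶ B} {t : D ⟶ B} (a : D ⟶ A)
    (h : a ≫ f = t) : (imageSubobject f).Factors t := by
  subst h
  exact factors_comp ((Subobject.factors_iff _ _).2
    ⟨factorThruImageSubobject f, imageSubobject_arrow_comp f⟩) a

/-- Elimination rule for images. -/
lemma factors_of_factors_imageSubobject {A B D : C} {f : A ⟶ B} {t : D ⟶ B}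
    (h : (imageSubobject f).Factors t) (U : Subobject D)
    (hU : ∀ {E : C} (s : E ⟶ D) (a : E ⟶ A), a ≫ f = s ≫ t → U.Factors s) :
    U.Factors (𝟙 D) := by
  have h0 : (imSub f).Factors t := Subobject.factors_of_le _ (imageSubobject_le_imSub f) h
  have h1 := (factors_allSub _ t).1 h0 (𝟙 D) (chi U)
  rw [Category.id_comp] at h1
  have h2 := (factors_impSub _ _ _).1 h1 (𝟙 D)
  refine (factors_genSub t U (𝟙 D)).1 (h2 ?_)
  rw [factors_allSub]
  intro E r a
  rw [factors_impSub]
  intro F s hs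
  rw [equalizerSubobject_factors_iff] at hs
  have hs' : (s ≫ a) ≫ f = (s ≫ r) ≫ t := by simpa using hs
  have h3 := (factors_genSub t U (s ≫ r)).2 (hU _ _ hs')
  simpa [pullback_factors_iff] using h3

/-! ### Generalized elements of power objects -/

/-- Membership between generalized elements of `X` and of `PX` at the same stage. -/
def Mem {D X : C} (x : D ⟶ X) (Y : D ⟶ Pow X) : Prop := (memSub X).Factors (lift x Y)

/-- The internal order between generalized elements of `PX`. -/
def Le {D X : C} (Y Z : D ⟶ Pow X) : Prop := (leSub X).Factors (lift Y Z)

lemma Mem.comp {D E X : C} {x : D ⟶ X} {Y : D ⟶ Pow X} (h : Mem x Y) (r : E ⟶ D) :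
    Mem (r ≫ x) (r ≫ Y) := by
  simpa [Mem] using factors_comp h r

/-- The beta rule for comprehension: currying and uncurrying cancel, so both sides pull `true` back
along the same morphism to `Ω`. -/
lemma mem_comp_compr {D A X : C} (x : D ⟶ X) (a : D ⟶ A) (S : Subobject (A ⊗ X)) :
    Mem x (a ≫ compr S) ↔ S.Factors (lift a x) := by
  have h : lift x (a ≫ compr S) ≫ MonoidalClosed.uncurry (𝟙 (Pow X)) = lift a x ≫ chi S := by
    have h1 : lift x (a ≫ compr S) = lift x a ≫ X ◁ compr S := by simp
    rw [h1, Category.assoc, ← MonoidalClosed.uncurry_natural_left, Category.comp_id, compr,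
      transpose, MonoidalClosed.uncurry_curry, ← Category.assoc]
    congr 1
    ext <;> simp
  rw [Mem, factors_iff_pullback_eq_top, memSub, ← extent_comp, h, extent_comp, extent_chi,
    ← factors_iff_pullback_eq_top]

lemma factors_rel {D A X : C} (f : A ⟶ Pow X) (a : D ⟶ A) (x : D ⟶ X) :
    (rel f).Factors (lift a x) ↔ Mem x (a ≫ f) := by
  have h : lift a x ≫ untranspose f =
      lift x (a ≫ f) ≫ MonoidalClosed.uncurry (𝟙 (Pow X)) := by
    have h1 : lift x (a ≫ f) = lift x a ≫ X ◁ f := by simp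
    rw [h1, Category.assoc, ← MonoidalClosed.uncurry_natural_left, Category.comp_id,
      untranspose, ← Category.assoc]
    congr 1
    ext <;> simp
  rw [Mem, factors_iff_pullback_eq_top, factors_iff_pullback_eq_top, memSub, rel,
    ← extent_comp, ← extent_comp, h]

lemma factors_memF {D Γ X : C} (t : D ⟶ Γ) (σ : Γ ⟶ X) (τ : Γ ⟶ Pow X) :
    (memF σ τ).Factors t ↔ Mem (t ≫ σ) (t ≫ τ) := by
  rw [memF, pullback_factors_iff, comp_lift, Mem]

lemma factors_leF {D Γ X : C} (t : D ⟶ Γ) (σ τ : Γ ⟶ Pow X) :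
    (leF σ τ).Factors t ↔ Le (t ≫ σ) (t ≫ τ) := by
  rw [leF, pullback_factors_iff, comp_lift, Le]

/-- The eta rule for comprehension; it reduces equality of elements of `PX` to equality of
relations. -/
lemma compr_rel {A X : C} (f : A ⟶ Pow X) : compr (rel f) = f := by
  rw [compr, rel, chi_extent, transpose, untranspose, ← Category.assoc]
  have h : lift (snd X A) (fst X A) ≫ lift (snd A X) (fst A X) = 𝟙 (X ⊗ A) := by
    ext <;> simp
  rw [h, Category.id_comp, MonoidalClosed.curry_uncurry]

/-- Extensionality for generalized elements of `PX`. -/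
lemma pow_ext {D X : C} {Y Z : D ⟶ Pow X}
    (h : ∀ {E : C} (r : E ⟶ D) (x : E ⟶ X), Mem x (r ≫ Y) ↔ Mem x (r ≫ Z)) : Y = Z := by
  rw [← compr_rel Y, ← compr_rel Z]
  congr 1
  have key : ∀ {Y Z : D ⟶ Pow X},
      (∀ {E : C} (r : E ⟶ D) (x : E ⟶ X), Mem x (r ≫ Y) → Mem x (r ≫ Z)) → rel Y ≤ rel Z := by
    intro Y Z h
    rw [le_iff_factors]
    intro E t ht
    have e : t = lift (t ≫ fst _ _) (t ≫ snd _ _) := by ext <;> simp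
    rw [e, factors_rel] at ht ⊢
    exact h _ _ ht
  exact le_antisymm (key fun r x => (h r x).1) (key fun r x => (h r x).2)

lemma mem_meetP {D X : C} (x : D ⟶ X) (Y Z : D ⟶ Pow X) :
    Mem x (lift Y Z ≫ meetP X) ↔ Mem x Y ∧ Mem x Z := by
  rw [meetP, mem_comp_compr, Subobject.inf_factors, factors_memF, factors_memF]
  simp

/-- The order is an equalizer, so `Le Y Z` means `Y ∧ Z = Y`, which extensionality turns into
inclusion at all later stages. -/
lemma le_iff {D X : C} (Y Z : D ⟶ Pow X) :
    Le Y Z ↔ ∀ {E : C} (r : E ⟶ D) (x : E ⟶ X), Mem x (r ≫ Y) → Mem x (r ≫ Z) := by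
  rw [Le, leSub, equalizerSubobject_factors_iff, lift_fst]
  constructor
  · intro h E r x hx
    rw [← h, ← Category.assoc, comp_lift, mem_meetP] at hx
    exact hx.2
  · intro h
    refine pow_ext fun r x => ?_
    rw [← Category.assoc, comp_lift, mem_meetP]
    exact ⟨fun hx => hx.1, fun hx => ⟨hx, h r x hx⟩⟩

lemma Le.comp {D E X : C} {Y Z : D ⟶ Pow X} (h : Le Y Z) (r : E ⟶ D) :
    Le (r ≫ Y) (r ≫ Z) := by
  simpa [Le] using factors_comp h r

lemma Le.mem {D X : C} {Y Z : D ⟶ Pow X} (h : Le Y Z) {x : D ⟶ X} (hx : Mem x Y) : Mem x Z := by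
  simpa using (le_iff Y Z).1 h (𝟙 D) x (by simpa using hx)

lemma Le.trans {D X : C} {Y Z W : D ⟶ Pow X} (h : Le Y Z) (h' : Le Z W) : Le Y W :=
  (le_iff Y W).2 fun r _ hx => (h'.comp r).mem ((h.comp r).mem hx)

lemma le_meetP_iff {D X : C} (W Y Z : D ⟶ Pow X) :
    Le W (lift Y Z ≫ meetP X) ↔ Le W Y ∧ Le W Z := by
  simp only [le_iff, ← Category.assoc, comp_lift, mem_meetP]
  exact ⟨fun h => ⟨fun r x hx => (h r x hx).1, fun r x hx => (h r x hx).2⟩,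
    fun h _ r x hx => ⟨h.1 r x hx, h.2 r x hx⟩⟩

lemma mem_joinP_left {D X : C} {x : D ⟶ X} {Y : D ⟶ Pow X} (h : Mem x Y) (Z : D ⟶ Pow X) :
    Mem x (lift Y Z ≫ joinP X) := by
  rw [joinP, mem_comp_compr]
  refine Subobject.factors_of_le _ le_sup_left ?_
  rw [factors_memF]
  simpa using h

lemma mem_joinP_right {D X : C} {x : D ⟶ X} (Y : D ⟶ Pow X) {Z : D ⟶ Pow X} (h : Mem x Z) :
    Mem x (lift Y Z ≫ joinP X) := by
  rw [joinP, mem_comp_compr]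
  refine Subobject.factors_of_le _ le_sup_right ?_
  rw [factors_memF]
  simpa using h

/-- Elimination rule for the join of `PX`, for conclusions of the form `x ∈ W`. -/
lemma mem_of_mem_joinP {D X X' : C} {x : D ⟶ X} {Y Z : D ⟶ Pow X}
    (h : Mem x (lift Y Z ≫ joinP X)) (x' : D ⟶ X') (W : D ⟶ Pow X')
    (hY : ∀ {E : C} (s : E ⟶ D), Mem (s ≫ x) (s ≫ Y) → Mem (s ≫ x') (s ≫ W))
    (hZ : ∀ {E : C} (s : E ⟶ D), Mem (s ≫ x) (s ≫ Z) → Mem (s ≫ x') (s ≫ W)) :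
    Mem x' W := by
  rw [joinP, mem_comp_compr] at h
  -- The conclusion `x' ∈ W` is the subobject `memF x' W` of `D` tested at the identity, so the
  -- elimination rule applies to it.
  have := factors_of_factors_sup h (memF x' W)
    (fun s hs => by rw [factors_memF] at hs ⊢; exact hY s (by simpa using hs))
    (fun s hs => by rw [factors_memF] at hs ⊢; exact hZ s (by simpa using hs))
  simpa [factors_memF] using this

lemma mem_const {D X : C} (x : D ⟶ X) (t : D ⟶ 𝟙_ C) (S : Subobject X) :
    Mem x (t ≫ const S) ↔ S.Factors x := by
  rw [const, mem_comp_compr, pullback_factors_iff, lift_snd]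

/-- The singleton morphism `x ↦ {x}`. -/
def singleton (X : C) : X ⟶ Pow X := compr (equalizerSubobject (fst X X) (snd X X))

lemma mem_singleton {D X : C} (y x : D ⟶ X) : Mem y (x ≫ singleton X) ↔ x = y := by
  rw [singleton, mem_comp_compr, equalizerSubobject_factors_iff, lift_fst, lift_snd]

/-! ### Generalized elements of erosions and dilations -/

lemma mem_erosion {D X : C} (b : X ⟶ Pow X) (x : D ⟶ X) (Y : D ⟶ Pow X) :
    Mem x (Y ≫ erosion b) ↔ Le (x ≫ b) Y := by
  rw [erosion, mem_comp_compr, pullback_factors_iff, geSub, pullback_factors_iff, Le]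
  simp

/-- An element of the image of `R_b` under the exchange yields, by elimination, an element of `R_b`
with its coordinates swapped; conversely such an element is its own witness. -/
lemma mem_breve {D X : C} (b : X ⟶ Pow X) (x y : D ⟶ X) :
    Mem y (x ≫ breve b) ↔ Mem x (y ≫ b) := by
  rw [breve, mem_comp_compr]
  constructor
  · intro h
    have := factors_of_factors_imageSubobject h (memF x (y ≫ b)) (fun s a ha => by
      rw [factors_memF, ← Category.assoc, ← factors_rel]
      refine (Subobject.factors_iff _ _).2 ⟨a, ?_⟩
      have h1 := congrArg (fun k => k ≫ fst _ _) ha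
      have h2 := congrArg (fun k => k ≫ snd _ _) ha
      simp only [Category.assoc, lift_fst, lift_snd] at h1 h2
      ext
      · simpa using h2
      · simpa using h1)
    simpa [factors_memF] using this
  · intro h
    rw [← factors_rel] at h
    exact factors_imageSubobject_of_eq ((rel b).factorThru _ h) (by simp)

lemma mk_tensorHom_factors_iff {A B A' B' D : C} (f : A ⟶ A') (g : B ⟶ B') [Mono f] [Mono g]
    (p : D ⟶ A') (q : D ⟶ B') :
    (Subobject.mk (f ⊗ₘ g)).Factors (lift p q) ↔
      (Subobject.mk f).Factors p ∧ (Subobject.mk g).Factors q := by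
  simp only [Subobject.mk_factors_iff]
  constructor
  · rintro ⟨(k : D ⟶ A ⊗ B), (hk : k ≫ (f ⊗ₘ g) = lift p q)⟩
    have h1 := congrArg (fun k => k ≫ fst _ _) hk
    have h2 := congrArg (fun k => k ≫ snd _ _) hk
    simp only [Category.assoc, tensorHom_fst, tensorHom_snd, lift_fst, lift_snd] at h1 h2
    exact ⟨⟨k ≫ fst _ _, (Category.assoc _ _ _).trans h1⟩,
      ⟨k ≫ snd _ _, (Category.assoc _ _ _).trans h2⟩⟩
  · rintro ⟨⟨(k : D ⟶ A), (hk : k ≫ f = p)⟩, ⟨(l : D ⟶ B), (hl : l ≫ g = q)⟩⟩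
    exact ⟨lift k l, (lift_map k l f g).trans (by rw [hk, hl])⟩

lemma factors_dilationRel {D X : C} (b : X ⟶ Pow X) (x y : D ⟶ X) (Y : D ⟶ Pow X) :
    (dilationRel b).Factors (lift x (lift y Y)) ↔ Mem x (y ≫ b) ∧ Mem y Y := by
  have e : lift x (lift y Y) ≫ lift (lift (fst _ _) (snd X (X ⊗ Pow X) ≫ fst _ _))
      (snd X (X ⊗ Pow X)) = lift (lift x y) (lift y Y) := by
    ext <;> simp
  rw [dilationRel, pullback_factors_iff, e, mk_tensorHom_factors_iff, Subobject.mk_arrow,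
    Subobject.mk_arrow, factors_rel, mem_breve, Mem, Mem]

/-- Introduction rule for the dilation. -/
lemma mem_dilation_of_mem {D X : C} {b : X ⟶ Pow X} {x y : D ⟶ X} {Y : D ⟶ Pow X}
    (h : Mem x (y ≫ b)) (hy : Mem y Y) : Mem x (Y ≫ dilation b) := by
  rw [dilation, mem_comp_compr]
  exact factors_imageSubobject_of_eq
    ((dilationRel b).factorThru _ ((factors_dilationRel b x y Y).2 ⟨h, hy⟩)) (by simp)

/-- Elimination rule for the dilation, for conclusions of the form `x' ∈ W`. -/
lemma mem_of_mem_dilation {D X X' : C} {b : X ⟶ Pow X} {x : D ⟶ X} {Y : D ⟶ Pow X}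
    (h : Mem x (Y ≫ dilation b)) (x' : D ⟶ X') (W : D ⟶ Pow X')
    (hW : ∀ {E : C} (s : E ⟶ D) (y : E ⟶ X), Mem (s ≫ x) (y ≫ b) → Mem y (s ≫ Y) →
      Mem (s ≫ x') (s ≫ W)) : Mem x' W := by
  rw [dilation, mem_comp_compr] at h
  have := factors_of_factors_imageSubobject h (memF x' W) (fun s a ha => by
    rw [factors_memF]
    have h1 := congrArg (fun k => k ≫ fst _ _) ha
    have h2 := congrArg (fun k => k ≫ snd _ _) ha
    simp only [Category.assoc, lift_fst, lift_snd] at h1 h2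
    -- The existential witness `y` is the middle coordinate of `a`; the outer two are forced by `ha`
    -- to be `x` and `Y` restricted along `s`.
    have h3 : (dilationRel b).Factors (lift (s ≫ x)
        (lift (a ≫ (dilationRel b).arrow ≫ snd _ _ ≫ fst _ _) (s ≫ Y))) := by
      refine (Subobject.factors_iff _ _).2 ⟨a, ?_⟩
      ext
      · simpa using h2
      · simp
      · simpa using h1
    rw [factors_dilationRel] at h3
    exact hW s _ h3.1 h3.2)
  simpa [factors_memF] using this

/-! ### Validity of closed formulas -/

/-- In a Heyting algebra, `φ ⇨ ψ = ⊤` means `φ ≤ ψ`; antisymmetry does the rest. -/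
lemma valid_iffF {φ ψ : Subobject (𝟙_ C)} : Valid (iffF φ ψ) ↔ φ = ψ := by
  rw [Valid, iffF]
  constructor
  · intro h
    have h' := eq_top_iff.1 h
    exact le_antisymm (himp_eq_top_iff.1 (eq_top_iff.2 (h'.trans inf_le_left)))
      (himp_eq_top_iff.1 (eq_top_iff.2 (h'.trans inf_le_right)))
  · rintro rfl
    rw [himp_self, inf_idem]

lemma valid_monotoneFormula {X : C} {f : Pow X ⟶ Pow X}
    (h : ∀ {D : C} (Y Z : D ⟶ Pow X), Le Y Z → Le (Y ≫ f) (Z ≫ f)) :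
    Valid (monotoneFormula f) := by
  refine eq_top_iff_factors.2 fun t => ?_
  rw [monotoneFormula, allF, allF, factors_allSub]
  intro E r Y
  rw [factors_allSub]
  intro F s Z
  refine (factors_impSub _ _ _).2 fun q hq => ?_
  rw [factors_leF] at hq ⊢
  simpa using h _ _ hq

lemma valid_preservesFormula {X : C} {op : Pow X ⊗ Pow X ⟶ Pow X} {f : Pow X ⟶ Pow X}
    (h : ∀ {D : C} (Y Z : D ⟶ Pow X),
      (lift Y Z ≫ op) ≫ f = lift (Y ≫ f) (Z ≫ f) ≫ op) :
    Valid (preservesFormula op f) := by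
  refine eq_top_iff_factors.2 fun t => ?_
  rw [preservesFormula, allF, allF, factors_allSub]
  intro E r Y
  rw [factors_allSub]
  intro F s Z
  rw [eqF, equalizerSubobject_factors_iff, h]

lemma valid_fixesFormula {X : C} {c : 𝟙_ C ⟶ Pow X} {f : Pow X ⟶ Pow X} (h : c ≫ f = c) :
    Valid (fixesFormula c f) := by
  refine eq_top_iff_factors.2 fun t => ?_
  rw [fixesFormula, eqF, equalizerSubobject_factors_iff, h]

lemma factors_reflexiveFormula {D X : C} (b : X ⟶ Pow X) (t : D ⟶ 𝟙_ C) :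
    (reflexiveFormula b).Factors t ↔ ∀ {E : C} (_ : E ⟶ D) (x : E ⟶ X), Mem x (x ≫ b) := by
  simp only [reflexiveFormula, allF, factors_allSub, factors_memF, lift_snd, lift_snd_assoc]

lemma factors_antiExtensiveFormula {D X : C} (f : Pow X ⟶ Pow X) (t : D ⟶ 𝟙_ C) :
    (antiExtensiveFormula f).Factors t ↔
      ∀ {E : C} (_ : E ⟶ D) (Y : E ⟶ Pow X), Le (Y ≫ f) Y := by
  simp only [antiExtensiveFormula, allF, factors_allSub, factors_leF, lift_snd, lift_snd_assoc]

lemma factors_extensiveFormula {D X : C} (f : Pow X ⟶ Pow X) (t : D ⟶ 𝟙_ C) :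
    (extensiveFormula f).Factors t ↔
      ∀ {E : C} (_ : E ⟶ D) (Y : E ⟶ Pow X), Le Y (Y ≫ f) := by
  simp only [extensiveFormula, allF, factors_allSub, factors_leF, lift_snd, lift_snd_assoc]

/-! ### Properties of erosion and dilation -/

variable {X : C} (b : X ⟶ Pow X)

lemma erosion_mono {D : C} {Y Z : D ⟶ Pow X} (h : Le Y Z) :
    Le (Y ≫ erosion b) (Z ≫ erosion b) := by
  rw [le_iff]
  intro E r x hx
  rw [← Category.assoc, mem_erosion] at hx ⊢
  exact hx.trans (h.comp r)

lemma dilation_mono {D : C} {Y Z : D ⟶ Pow X} (h : Le Y Z) :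
    Le (Y ≫ dilation b) (Z ≫ dilation b) := by
  rw [le_iff]
  intro E r x hx
  rw [← Category.assoc] at hx
  refine mem_of_mem_dilation hx _ _ fun s y hy hY => ?_
  have := mem_dilation_of_mem hy (((h.comp r).comp s).mem hY)
  simpa using this

/-- Both sides contain `x` exactly when `b(x)` lies below `Y` and below `Z`. -/
lemma erosion_meetP {D : C} (Y Z : D ⟶ Pow X) :
    (lift Y Z ≫ meetP X) ≫ erosion b = lift (Y ≫ erosion b) (Z ≫ erosion b) ≫ meetP X := by
  refine pow_ext fun r x => ?_
  rw [← Category.assoc, mem_erosion, ← Category.assoc, comp_lift, le_meetP_iff,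
    ← Category.assoc, comp_lift, mem_meetP, ← Category.assoc, ← Category.assoc, mem_erosion,
    mem_erosion]

lemma dilation_joinP {D : C} (Y Z : D ⟶ Pow X) :
    (lift Y Z ≫ joinP X) ≫ dilation b =
      lift (Y ≫ dilation b) (Z ≫ dilation b) ≫ joinP X := by
  have le_left {E : C} (Y Z : E ⟶ Pow X) : Le Y (lift Y Z ≫ joinP X) := by
    rw [le_iff]
    intro F r x hx
    rw [← Category.assoc, comp_lift]
    exact mem_joinP_left hx _
  have le_right {E : C} (Y Z : E ⟶ Pow X) : Le Z (lift Y Z ≫ joinP X) := by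
    rw [le_iff]
    intro F r x hx
    rw [← Category.assoc, comp_lift]
    exact mem_joinP_right _ hx
  refine pow_ext fun r x => ⟨fun hx => ?_, fun hx => ?_⟩
  · rw [← Category.assoc] at hx
    refine mem_of_mem_dilation hx _ _ fun s y hy hyYZ => ?_
    have hyYZ' : Mem y (lift (s ≫ r ≫ Y) (s ≫ r ≫ Z) ≫ joinP X) := by
      simpa [← comp_lift_assoc] using hyYZ
    -- The case distinction is on the witness `y`, one stage after it appears; in each case the same
    -- `y` puts `x` in one of the two dilations.
    refine mem_of_mem_joinP hyYZ' _ _ (fun q hq => ?_) (fun q hq => ?_)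
    · have := mem_joinP_left (mem_dilation_of_mem (by simpa using hy.comp q) hq)
        (q ≫ s ≫ r ≫ Z ≫ dilation b)
      simpa [← comp_lift_assoc] using this
    · have := mem_joinP_right (q ≫ s ≫ r ≫ Y ≫ dilation b)
        (mem_dilation_of_mem (by simpa using hy.comp q) hq)
      simpa [← comp_lift_assoc] using this
  -- This inclusion is monotonicity of the dilation alone, applied to `Y ⪯ Y ∨ Z` and `Z ⪯ Y ∨ Z`.
  · rw [← Category.assoc, comp_lift] at hx
    refine mem_of_mem_joinP hx _ _ (fun s hs => ?_) (fun s hs => ?_)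
    · exact (((dilation_mono b (le_left Y Z)).comp r).comp s).mem hs
    · exact (((dilation_mono b (le_right Y Z)).comp r).comp s).mem hs

lemma const_top_erosion :
    const (⊤ : Subobject X) ≫ erosion b = const (⊤ : Subobject X) := by
  refine pow_ext fun r x => ⟨fun _ => ?_, fun _ => ?_⟩
  · rw [mem_const]
    exact Subobject.top_factors x
  · rw [← Category.assoc, mem_erosion, le_iff]
    intro F s y _
    rw [← Category.assoc, mem_const]
    exact Subobject.top_factors y

lemma const_bot_dilation :
    const (⊥ : Subobject X) ≫ dilation b = const (⊥ : Subobject X) := by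
  refine pow_ext fun r x => ⟨fun hx => ?_, fun hx => ?_⟩
  · rw [← Category.assoc] at hx
    refine mem_of_mem_dilation hx _ _ fun s y _ hY => ?_
    rw [← Category.assoc, mem_const] at hY
    -- A point `y` of the empty subobject makes everything true at its stage.
    simpa [factors_memF] using
      factors_of_factors_bot hY (memF (s ≫ x) (s ≫ r ≫ const (⊥ : Subobject X)))
  · rw [mem_const] at hx
    simpa [factors_memF] using
      factors_of_factors_bot hx (memF x (r ≫ const (⊥ : Subobject X) ≫ dilation b))

lemma reflexiveFormula_eq_antiExtensiveFormula :
    reflexiveFormula b = antiExtensiveFormula (erosion b) := by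
  refine le_antisymm (le_iff_factors.2 fun t ht => ?_) (le_iff_factors.2 fun t ht => ?_)
  · rw [factors_reflexiveFormula] at ht
    rw [factors_antiExtensiveFormula]
    intro E r Y
    rw [le_iff]
    intro F s x hx
    rw [← Category.assoc, mem_erosion] at hx
    exact hx.mem (ht (s ≫ r) x)
  · rw [factors_antiExtensiveFormula] at ht
    rw [factors_reflexiveFormula]
    intro E r x
    -- Anti-extensivity is tested at `Y = b(x)`: reflexivity of the order puts `x` in `ε(b(x))`,
    -- hence in `b(x)`.
    refine (ht r (x ≫ b)).mem ?_
    rw [mem_erosion, le_iff]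
    exact fun _ _ h => h

lemma reflexiveFormula_eq_extensiveFormula :
    reflexiveFormula b = extensiveFormula (dilation b) := by
  refine le_antisymm (le_iff_factors.2 fun t ht => ?_) (le_iff_factors.2 fun t ht => ?_)
  · rw [factors_reflexiveFormula] at ht
    rw [factors_extensiveFormula]
    intro E r Y
    rw [le_iff]
    intro F s x hx
    rw [← Category.assoc]
    -- The point `x` is its own witness.
    exact mem_dilation_of_mem (ht (s ≫ r) x) hx
  · rw [factors_extensiveFormula] at ht
    rw [factors_reflexiveFormula]
    intro E r x
    -- Extensivity is tested at `Y = {x}`: the witness `y` for `x ∈ δ({x})` lies in `{x}`, so it is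
    -- `x`, and `x ∈ b(y)` becomes `x ∈ b(x)`.
    have hx := (ht r (x ≫ singleton X)).mem ((mem_singleton x x).2 rfl)
    refine mem_of_mem_dilation hx _ _ fun s y hy hxy => ?_
    rw [← Category.assoc, mem_singleton] at hxy
    subst hxy
    simpa using hy

end ToposMorphology

end

theorem proposition2 {C : Type u} [Category.{v} C] [CartesianMonoidalCategory C]
    [HasFiniteLimits C] [MonoidalClosed C] [HasSubobjectClassifier C]
    {X : C} (b : X ⟶ Pow X) :
    -- monotonicity
    Valid (monotoneFormula (erosion b)) ∧
    Valid (monotoneFormula (dilation b)) ∧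
    -- erosion preserves meets, dilation preserves joins
    Valid (preservesFormula (meetP X) (erosion b)) ∧
    Valid (preservesFormula (joinP X) (dilation b)) ∧
    -- `ε[b](X) = X` and `δ[b](∅) = ∅`
    Valid (fixesFormula (const (⊤ : Subobject X)) (erosion b)) ∧
    Valid (fixesFormula (const (⊥ : Subobject X)) (dilation b)) ∧
    -- (anti-)extensivity, as valid equivalences of the internal logic
    Valid (iffF (reflexiveFormula b) (antiExtensiveFormula (erosion b))) ∧
    Valid (iffF (reflexiveFormula b) (extensiveFormula (dilation b))) ∧
    -- and as equivalences of the validity of the formulas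
    (Valid (antiExtensiveFormula (erosion b)) ↔ Valid (reflexiveFormula b)) ∧
    (Valid (extensiveFormula (dilation b)) ↔ Valid (reflexiveFormula b)) := by
  exact ⟨valid_monotoneFormula fun _ _ => erosion_mono b,
    valid_monotoneFormula fun _ _ => dilation_mono b,
    valid_preservesFormula fun Y Z => erosion_meetP b Y Z,
    valid_preservesFormula fun Y Z => dilation_joinP b Y Z,
    valid_fixesFormula (const_top_erosion b),
    valid_fixesFormula (const_bot_dilation b),
    valid_iffF.2 (reflexiveFormula_eq_antiExtensiveFormula b),
    valid_iffF.2 (reflexiveFormula_eq_extensiveFormula b),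
    by rw [reflexiveFormula_eq_antiExtensiveFormula b],
    by rw [reflexiveFormula_eq_extensiveFormula b]⟩
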